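/- **Theorem** (Pinkall). Let $m_1,\dots,m_g$ be positive integers with $m_1+\cdots+m_g=n-1$. Then there exists a proper Dupin hypersurface in $\mathbb{R}^n$ with $g$ distinct principal curvatures having respective multiplicities $m_1,\dots,m_g$. More precisely, there are a connected (non-empty) smooth manifold $M$ of dimension $n-1$, a smooth embedding $f:M\to\mathbb{R}^n$ with a smooth field of unit normals $\xi$, and smooth functions $\kappa_1,\dots,\kappa_g:M\to\mathbb{R}$ such that $f$ is a proper Dupin hypersurface and, at every $x\in M$, the numbers $\kappa_1(x),\dots,\kappa_g(x)$ are pairwise distinct, are exactly the principal curvatures of $f$ at $x$, and have multiplicities $m_1,\dots,m_g$ respectively. Here the principal curvatures of $f$ at $x$ are the eigenvalues of the shape operator $A:T_xM\to T_xM$, defined by $df(AX)=-d\xi(X)$; the principal spaces are its eigenspaces, and the multiplicity of a principal curvature is the dimension of its principal space. A curvature surface is a connected smooth (injectively immersed) submanifold $S\subset M$ such that for each $x\in S$ the tangent space $T_xS$ is a principal space at $x$. The hypersurface is Dupin if along each curvature surface the corresponding principal curvature is constant, and proper Dupin if, in addition, the number of distinct principal curvatures is constant on $M$. -/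

import Mathlib

open scoped Manifold ContDiff InnerProductSpace

noncomputable section

/-- Euclidean space `ℝⁿ`. -/
abbrev Euc (n : ℕ) : Type := EuclideanSpace ℝ (Fin n)

section Hypersurfaces

universe u

variable {d n : ℕ} {M : Type u} [TopologicalSpace M] [ChartedSpace (Euc d) M]

/-- The differential `T_x M → ℝⁿ` of a map `f : M → ℝⁿ`, with every tangent space of `ℝⁿ`
identified with `ℝⁿ`. -/
def diffAt (f : M → Euc n) (x : M) : TangentSpace (𝓡 d) x →L[ℝ] Euc n :=
  mfderiv (𝓡 d) (𝓡 n) f x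

/-- `f : M → ℝⁿ` is an oriented (immersed, smooth) hypersurface with field of unit normal
vectors `ξ : M → ℝⁿ`; here `M` is a smooth manifold of dimension `d = n - 1`. -/
structure IsOrientedHypersurface (f ξ : M → Euc n) : Prop where
  /-- The codimension is one. -/
  codim_one : d + 1 = n
  /-- The map `f` is smooth. -/
  smooth : ContMDiff (𝓡 d) (𝓡 n) ∞ f
  /-- The map `f` is an immersion. -/
  immersion : ∀ x, Function.Injective (diffAt (d := d) f x)
  /-- The field `ξ` is smooth. -/
  smooth_normal : ContMDiff (𝓡 d) (𝓡 n) ∞ ξ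
  /-- The field `ξ` has length one. -/
  norm_normal : ∀ x, ‖ξ x‖ = 1
  /-- The field `ξ` is normal to the hypersurface. -/
  orthogonal : ∀ x (X : TangentSpace (𝓡 d) x), ⟪ξ x, diffAt f x X⟫_ℝ = 0

/-- For an oriented hypersurface there is a linear map `A` on `T_x M` with
`df (A X) = - dξ X` for all `X`. -/
theorem IsOrientedHypersurface.exists_shapeOperator {f ξ : M → Euc n}
    (h : IsOrientedHypersurface (d := d) f ξ) (x : M) :
    ∃ A : Module.End ℝ (TangentSpace (𝓡 d) x),
      ∀ X, diffAt f x (A X) = - diffAt ξ x X := by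
  have hdξ : MDifferentiableAt (𝓡 d) (𝓡 n) ξ x :=
    h.smooth_normal.mdifferentiable (by simp) x
  -- the derivative of `ξ` is tangential
  have hperp : ∀ X, ⟪ξ x, diffAt (d := d) ξ x X⟫_ℝ = 0 := by
    intro X
    have hN : MDifferentiableAt (𝓡 n) 𝓘(ℝ, ℝ) (fun v : Euc n => ‖v‖ ^ 2) (ξ x) :=
      ((contDiff_norm_sq ℝ (n := 1)).differentiable (by simp) (ξ x)).mdifferentiableAt
    have hc := mfderiv_comp x hN hdξ
    have hone : (fun v : Euc n => ‖v‖ ^ 2) ∘ ξ = fun _ : M => (1 : ℝ) := by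
      funext y
      simp [h.norm_normal y]
    rw [hone, mfderiv_const, mfderiv_eq_fderiv] at hc
    have h0 : (0 : ℝ) = fderiv ℝ (fun v : Euc n => ‖v‖ ^ 2) (ξ x) (diffAt (d := d) ξ x X) :=
      DFunLike.congr_fun hc X
    rw [fderiv_norm_sq_apply] at h0
    simpa using h0
  -- the tangent space is the orthogonal complement of the normal
  have hne : ξ x ≠ 0 := by
    intro h0
    have := h.norm_normal x
    simp [h0] at this
  let L : TangentSpace (𝓡 d) x →ₗ[ℝ] Euc n := (diffAt (d := d) f x).toLinearMap
  have hL : Function.Injective L := h.immersion x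
  have hle : LinearMap.range L ≤ (ℝ ∙ ξ x)ᗮ := by
    rintro _ ⟨X, rfl⟩
    rw [Submodule.mem_orthogonal_singleton_iff_inner_right]
    exact h.orthogonal x X
  have hdim : Module.finrank ℝ (TangentSpace (𝓡 d) x) = d :=
    finrank_euclideanSpace_fin (𝕜 := ℝ) (n := d)
  have hfact : Fact (Module.finrank ℝ (Euc n) = d + 1) := ⟨by simp [h.codim_one]⟩
  have heq : LinearMap.range L = (ℝ ∙ ξ x)ᗮ := by
    apply Submodule.eq_of_le_of_finrank_eq hle
    rw [LinearMap.finrank_range_of_inj hL, hdim,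
      Submodule.finrank_orthogonal_span_singleton (n := d) hne]
  have hmem : ∀ X, -(diffAt (d := d) ξ x X) ∈ LinearMap.range L := by
    intro X
    rw [heq, Submodule.mem_orthogonal_singleton_iff_inner_right, inner_neg_right, hperp X, neg_zero]
  refine ⟨(LinearEquiv.ofInjective L hL).symm.toLinearMap ∘ₗ
    LinearMap.codRestrict (LinearMap.range L) (-(diffAt (d := d) ξ x).toLinearMap) hmem, ?_⟩
  intro X
  exact congrArg Subtype.val ((LinearEquiv.ofInjective L hL).apply_symm_apply
    (LinearMap.codRestrict (LinearMap.range L) (-(diffAt (d := d) ξ x).toLinearMap) hmem X))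

open Classical in
/-- The shape operator `A : T_x M → T_x M` at `x` of an oriented hypersurface `f` with field of
unit normals `ξ`: the linear map determined by `df (A X) = - dξ X`. It exists and is unique by
the theorems next to this definition (the value is `0` when there is no such map, which does not
happen for an oriented hypersurface). -/
def shapeOperator (f ξ : M → Euc n) (x : M) : Module.End ℝ (TangentSpace (𝓡 d) x) :=
  if h : ∃ A : Module.End ℝ (TangentSpace (𝓡 d) x),
      ∀ X, diffAt f x (A X) = - diffAt ξ x X
  then h.choose else 0

theorem IsOrientedHypersurface.diffAt_shapeOperator {f ξ : M → Euc n}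
    (h : IsOrientedHypersurface (d := d) f ξ) (x : M) (X : TangentSpace (𝓡 d) x) :
    diffAt f x (shapeOperator f ξ x X) = - diffAt ξ x X := by
  have hA := h.exists_shapeOperator x
  unfold shapeOperator
  rw [dif_pos hA]
  exact hA.choose_spec X

theorem IsOrientedHypersurface.eq_shapeOperator {f ξ : M → Euc n}
    (h : IsOrientedHypersurface (d := d) f ξ) (x : M)
    (A : Module.End ℝ (TangentSpace (𝓡 d) x))
    (hA : ∀ X, diffAt f x (A X) = - diffAt ξ x X) : A = shapeOperator f ξ x := by
  ext1 X
  apply h.immersion x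
  rw [hA, h.diffAt_shapeOperator]

/-- `c` is a principal curvature at `x`: an eigenvalue of the shape operator at `x`. -/
def IsPrincipalCurvatureAt (f ξ : M → Euc n) (x : M) (c : ℝ) : Prop :=
  Module.End.HasEigenvalue (shapeOperator (d := d) f ξ x) c

/-- The principal space at `x` of `c`: the eigenspace of the shape operator at `x`. -/
def principalSpace (f ξ : M → Euc n) (x : M) (c : ℝ) :
    Submodule ℝ (TangentSpace (𝓡 d) x) :=
  Module.End.eigenspace (shapeOperator f ξ x) c

/-- The multiplicity of `c` at `x`: the dimension of the principal space. -/
def multiplicityAt (f ξ : M → Euc n) (x : M) (c : ℝ) : ℕ :=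
  Module.finrank ℝ (principalSpace (d := d) f ξ x c)

/-- `ι : S → M` is a curvature surface, with corresponding principal curvature `κ : S → ℝ`: it is
an (injectively immersed) smooth submanifold whose tangent space at each point `s` is the
principal space of the principal curvature `κ s`. The map `κ` is determined by `ι`, and it
is not assumed to be continuous. -/
structure IsCurvatureSurface (f ξ : M → Euc n) {k : ℕ} {S : Type u} [TopologicalSpace S]
    [ChartedSpace (Euc k) S] (ι : S → M) (κ : S → ℝ) : Prop where
  smooth : ContMDiff (𝓡 k) (𝓡 d) ∞ ι
  injective : Function.Injective ι
  immersion : ∀ s, Function.Injective (mfderiv (𝓡 k) (𝓡 d) ι s)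
  principal : ∀ s, IsPrincipalCurvatureAt (d := d) f ξ (ι s) (κ s)
  tangent : ∀ s,
    LinearMap.range (mfderiv (𝓡 k) (𝓡 d) ι s).toLinearMap = principalSpace f ξ (ι s) (κ s)

/-- The Dupin condition: along each (connected) curvature surface, of any dimension, the
corresponding principal curvature is constant. -/
def IsDupin (d : ℕ) {n : ℕ} {M : Type u} [TopologicalSpace M] [ChartedSpace (Euc d) M]
    (f ξ : M → Euc n) : Prop :=
  ∀ (k : ℕ) (S : Type u) [TopologicalSpace S] [ChartedSpace (Euc k) S] [IsManifold (𝓡 k) ∞ S]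
    [ConnectedSpace S] (ι : S → M) (κ : S → ℝ),
    IsCurvatureSurface (d := d) (k := k) f ξ ι κ → ∀ s t, κ s = κ t

/-- A proper Dupin hypersurface: an oriented hypersurface that is Dupin and whose number of
distinct principal curvatures is the same at all points. -/
structure IsProperDupin (d : ℕ) {n : ℕ} {M : Type u} [TopologicalSpace M]
    [ChartedSpace (Euc d) M] (f ξ : M → Euc n) : Prop where
  hypersurface : IsOrientedHypersurface (d := d) f ξ
  dupin : IsDupin d f ξ
  card_const : ∀ x y : M,
    {c | IsPrincipalCurvatureAt (d := d) f ξ x c}.ncard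
      = {c | IsPrincipalCurvatureAt (d := d) f ξ y c}.ncard

/-- The hypersurface has exactly `g` distinct principal curvatures at each point, given by smooth
functions `κ 0, …, κ (g - 1)`, of multiplicities `m 0, …, m (g - 1)` respectively. -/
def HasPrincipalCurvaturesOfMultiplicity (d : ℕ) {n : ℕ} {M : Type u} [TopologicalSpace M]
    [ChartedSpace (Euc d) M] (f ξ : M → Euc n) {g : ℕ} (m : Fin g → ℕ) : Prop :=
  ∃ κ : Fin g → M → ℝ,
    (∀ i, ContMDiff (𝓡 d) 𝓘(ℝ, ℝ) ∞ (κ i)) ∧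
    ∀ x, Function.Injective (fun i => κ i x) ∧
      {c | IsPrincipalCurvatureAt (d := d) f ξ x c} = Set.range (fun i => κ i x) ∧
      ∀ i, multiplicityAt (d := d) f ξ x (κ i x) = m i

end Hypersurfaces

end

/-! Induction on the number of principal curvatures. Given a Dupin hypersurface in the Euclidean
space `F` with a unit vector `e`, raise it in the direction `e` by a constant `c` and rotate it
about `eᗮ` inside `F × G`: the component `ρ = ⟪f, e⟫ + c` along `e` is replaced by `ρ • (α, β)`,
where `(α, β)` runs over a cap of the unit sphere of `ℝ × G`. Rotating `ξ` in the same way, without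
the shift, gives the unit normal. Along the profile the principal curvatures and their principal
directions persist. The rotation directions form a new principal space of dimension `dim G`, with
curvature `-⟪ξ, e⟫ / ρ`; this does not depend on the rotation parameter, so it is constant along
that space.

The new curvature must differ from the old ones everywhere. If all old ones are at most `-a`, a
large shift `c` keeps the new one at least `-a / 2`. The bounds in `IsRotatableDupin` on height,
slope and curvatures make this work uniformly, and they survive the rotation because the cap has `α
≥ 1 / 2` (`IsRotatableDupin.rotate`). Using a cap rather than the whole sphere keeps the domain a
Euclidean space, so connectedness is automatic.

It remains to match this parametrized description with the intrinsic one: a dimension count shows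
that the known eigenvectors fill the eigenspaces, and the constancy of curvatures on principal
spaces integrates along curvature surfaces (`IsRotatableDupin.isDupin`). -/

/-! ### Linear algebra: counting dimensions of eigenspaces -/

open Module in
/-- A family of independent subspaces whose dimensions add up to the dimension of the space
spans it. -/
theorem iSup_eq_top_of_sum_finrank_eq {V : Type*} [AddCommGroup V] [Module ℝ V]
    [FiniteDimensional ℝ V] {g : ℕ} {p : Fin g → Submodule ℝ V} (hp : iSupIndep p)
    (hsum : ∑ i, finrank ℝ (p i) = finrank ℝ V) : ⨆ i, p i = ⊤ := by
  classical
  have hinj : Function.Injective (DirectSum.coeLinearMap p) := hp.dfinsupp_lsum_injective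
  have hdim : finrank ℝ (DirectSum (Fin g) fun i => p i) = finrank ℝ V := by
    rw [finrank_directSum, hsum]
  have hsurj := (LinearMap.injective_iff_surjective_of_finrank_eq_finrank hdim).1 hinj
  rw [← DirectSum.range_coeLinearMap]
  exact LinearMap.range_eq_top.2 hsurj

open Module in
theorem sum_finrank_le_of_iSupIndep {V : Type*} [AddCommGroup V] [Module ℝ V]
    [FiniteDimensional ℝ V] {g : ℕ} {p : Fin g → Submodule ℝ V} (hp : iSupIndep p) :
    ∑ i, finrank ℝ (p i) ≤ finrank ℝ V := by
  classical
  have hinj : Function.Injective (DirectSum.coeLinearMap p) := hp.dfinsupp_lsum_injective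
  rw [← finrank_directSum]
  exact LinearMap.finrank_le_finrank_of_injective hinj

open Module in
/-- Subspaces of eigenvectors for distinct eigenvalues whose dimensions add up to the dimension of
the space are the full eigenspaces, and there are no further eigenvalues. -/
theorem eigenspace_eq_of_sum_finrank_eq {V : Type*} [AddCommGroup V] [Module ℝ V]
    [FiniteDimensional ℝ V] {g : ℕ} (A : End ℝ V) {c : Fin g → ℝ}
    (hc : Function.Injective c) {D : Fin g → Submodule ℝ V} {m : Fin g → ℕ} (hm : ∀ i, 0 < m i)
    (hD : ∀ i, D i ≤ A.eigenspace (c i)) (hdim : ∀ i, finrank ℝ (D i) = m i)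
    (hsum : ∑ i, m i = finrank ℝ V) :
    (∀ i, A.eigenspace (c i) = D i) ∧ {a | A.HasEigenvalue a} = Set.range c := by
  have hind := A.eigenspaces_iSupIndep
  have hle : ∀ i, m i ≤ finrank ℝ (A.eigenspace (c i)) := fun i =>
    (hdim i).symm.le.trans (Submodule.finrank_mono (hD i))
  have htot := sum_finrank_le_of_iSupIndep (hind.comp hc)
  have heq : ∀ i, m i = finrank ℝ (A.eigenspace (c i)) := by
    have h := (Finset.sum_eq_sum_iff_of_le (s := Finset.univ) fun i _ => hle i).1
      (le_antisymm (Finset.sum_le_sum fun i _ => hle i) (htot.trans_eq hsum.symm))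
    exact fun i => h i (Finset.mem_univ i)
  have htop : ⨆ i, A.eigenspace (c i) = ⊤ :=
    iSup_eq_top_of_sum_finrank_eq (hind.comp hc) (by
      rw [← hsum]
      exact Finset.sum_congr rfl fun i _ => (heq i).symm)
  refine ⟨fun i => (Submodule.eq_of_le_of_finrank_eq (hD i)
    ((hdim i).trans (heq i))).symm, ?_⟩
  ext a
  simp only [Set.mem_ofPred_eq, Set.mem_range]
  constructor
  · intro ha
    -- A further eigenspace would be independent of the listed ones, which already span the space.
    by_contra! hne
    refine ha ?_
    have hdisj := hind a
    rw [← disjoint_top, ← top_le_iff.1 (htop.ge.trans (iSup_le fun i =>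
      le_iSup₂_of_le (f := fun b (_ : b ≠ a) => A.eigenspace b) (c i) (hne i) le_rfl))]
    exact hdisj
  · rintro ⟨i, rfl⟩ h0
    have := heq i
    have hi := hm i
    change A.eigenspace (c i) = ⊥ at h0
    rw [h0, finrank_bot] at this
    omega

/-! ### Spherical caps -/

section Cap

variable {G : Type*} [NormedAddCommGroup G] [InnerProductSpace ℝ G]

/-- A parametrization `u ↦ (α u, β u)` of a spherical cap in `ℝ × G` around the pole `(1, 0)`. -/
structure IsSphericalCap (α : G → ℝ) (β : G → G) : Prop where
  contDiff_fst : ContDiff ℝ ∞ α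
  contDiff_snd : ContDiff ℝ ∞ β
  half_le : ∀ u, 1 / 2 ≤ α u
  sphere : ∀ u, α u ^ 2 + ‖β u‖ ^ 2 = 1
  embedding : Topology.IsEmbedding fun u => (α u)⁻¹ • β u
  immersion : ∀ u k, fderiv ℝ α u k = 0 → fderiv ℝ β u k = 0 → k = 0

/-- Derivative of the equation of the unit sphere. -/
theorem IsSphericalCap.inner_deriv {α : G → ℝ} {β : G → G} (h : IsSphericalCap α β) (u k : G) :
    α u * fderiv ℝ α u k + ⟪β u, fderiv ℝ β u k⟫_ℝ = 0 := by
  have h1 := ((h.contDiff_fst.differentiable (by simp) u).hasFDerivAt.pow 2).add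
    ((h.contDiff_snd.differentiable (by simp) u).hasFDerivAt.norm_sq)
  have h2 : HasFDerivAt (fun u => α u ^ 2 + ‖β u‖ ^ 2) (0 : G →L[ℝ] ℝ) u := by
    simp only [h.sphere]
    exact hasFDerivAt_const _ _
  have h3 := DFunLike.congr_fun (h1.unique h2) k
  simp at h3
  linarith

/-- Shrink `G` diffeomorphically onto its unit ball by `w` and project the point `(1, w)` centrally
to the sphere. Then `β / α = w` is an embedding, and `‖w‖ < 1` keeps `α` above `1 / 2`. -/
theorem exists_isSphericalCap : ∃ (α : G → ℝ) (β : G → G), IsSphericalCap α β := by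
  let w : G → G := OpenPartialHomeomorph.univUnitBall
  have hw : ContDiff ℝ ∞ w := OpenPartialHomeomorph.contDiff_univUnitBall
  have hball : ∀ u, w u ∈ Metric.ball (0 : G) 1 := fun u =>
    OpenPartialHomeomorph.univUnitBall.map_source (Set.mem_univ u)
  have hlt : ∀ u, ‖w u‖ < 1 := fun u => mem_ball_zero_iff.1 (hball u)
  have hpos : ∀ u, 0 < 1 + ‖w u‖ ^ 2 := fun u => by positivity
  have hwemb : Topology.IsEmbedding w :=
    Topology.IsEmbedding.subtypeVal.comp Homeomorph.unitBall.isEmbedding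
  have hwinj : ∀ u k, fderiv ℝ w u k = 0 → k = 0 := by
    intro u k hk
    have hs : DifferentiableAt ℝ (OpenPartialHomeomorph.univUnitBall (E := G)).symm (w u) :=
      ((OpenPartialHomeomorph.contDiffOn_univUnitBall_symm (n := 1)).contDiffAt
        (Metric.isOpen_ball.mem_nhds (hball u))).differentiableAt (by simp)
    have hcomp := hs.hasFDerivAt.comp u (hw.differentiable (by simp) u).hasFDerivAt
    have hid : ((OpenPartialHomeomorph.univUnitBall (E := G)).symm ∘ w) = id := by
      funext v
      exact OpenPartialHomeomorph.univUnitBall.left_inv (Set.mem_univ v)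
    rw [hid] at hcomp
    have := DFunLike.congr_fun ((hasFDerivAt_id u).unique hcomp) k
    simpa [hk] using this
  let α : G → ℝ := fun u => (√(1 + ‖w u‖ ^ 2))⁻¹
  have hsq : ∀ u, α u ^ 2 * (1 + ‖w u‖ ^ 2) = 1 := fun u => by
    simp only [α, inv_pow, Real.sq_sqrt (hpos u).le]
    exact inv_mul_cancel₀ (hpos u).ne'
  have hα0 : ∀ u, 0 < α u := fun u => inv_pos.2 (Real.sqrt_pos.2 (hpos u))
  have hα : ContDiff ℝ ∞ α := by
    refine ContDiff.inv (ContDiff.sqrt (contDiff_const.add (hw.norm_sq ℝ))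
      fun u => (hpos u).ne') fun u => (Real.sqrt_pos.2 (hpos u)).ne'
  have hβ : ContDiff ℝ ∞ fun u => α u • w u := hα.smul hw
  refine ⟨α, fun u => α u • w u, hα, hβ, fun u => ?_, fun u => ?_, ?_, fun u k h1 h2 => ?_⟩
  · have h1 := hsq u
    have h2 := hlt u
    have h3 := norm_nonneg (w u)
    have h4 : ‖w u‖ ^ 2 ≤ 1 := by nlinarith
    by_contra! hlt
    nlinarith [hα0 u, sq_nonneg (α u)]
  · rw [norm_smul, mul_pow, Real.norm_eq_abs, sq_abs, ← hsq u]
    ring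
  · have : (fun u => (α u)⁻¹ • α u • w u) = w := by
      funext u
      rw [inv_smul_smul₀ (hα0 u).ne']
    rw [this]
    exact hwemb
  · have := ((hα.differentiable (by simp) u).hasFDerivAt.smul
      (hw.differentiable (by simp) u).hasFDerivAt).fderiv
    change fderiv ℝ (fun u => α u • w u) u = _ at this
    rw [this] at h2
    simp [h1, (hα0 u).ne'] at h2
    exact hwinj u k h2

end Cap

/-! ### Rotating a hypersurface about a hyperplane -/

section Rotation

variable {E F G F' : Type*} [NormedAddCommGroup E] [NormedSpace ℝ E]
  [NormedAddCommGroup F] [InnerProductSpace ℝ F]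
  [NormedAddCommGroup G] [InnerProductSpace ℝ G]
  [NormedAddCommGroup F'] [InnerProductSpace ℝ F']

/-- A parametrized hypersurface `f : E → F` with unit normals `ξ`, having principal curvatures
`κ i` of multiplicities `m i` that are constant along their principal spaces, and such that the
height of `f` over `eᗮ` is positive and bounded, and the slope `⟪ξ, e⟫` and the `-κ i` are bounded
below by a positive number. -/
structure IsRotatableDupin (f ξ : E → F) (e : F) {g : ℕ} (κ : Fin g → E → ℝ) (m : Fin g → ℕ) :
    Prop where
  contDiff_map : ContDiff ℝ ∞ f
  contDiff_normal : ContDiff ℝ ∞ ξ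
  contDiff_curvature : ∀ i, ContDiff ℝ ∞ (κ i)
  embedding : Topology.IsEmbedding f
  immersion : ∀ x, Function.Injective (fderiv ℝ f x)
  norm_normal : ∀ x, ‖ξ x‖ = 1
  orthogonal : ∀ x h, ⟪ξ x, fderiv ℝ f x h⟫_ℝ = 0
  principal : ∀ i x, ∃ D : Submodule ℝ E, Module.finrank ℝ D = m i ∧
    ∀ h ∈ D, fderiv ℝ ξ x h = -(κ i x • fderiv ℝ f x h) ∧ fderiv ℝ (κ i) x h = 0
  injective : ∀ x, Function.Injective fun i => κ i x
  norm_axis : ‖e‖ = 1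
  height : ∃ B, ∀ x, 0 < ⟪f x, e⟫_ℝ ∧ ⟪f x, e⟫_ℝ ≤ B
  slope : ∃ a > 0, ∀ x, a ≤ ⟪ξ x, e⟫_ℝ ∧ ∀ i, κ i x ≤ -a

/-- The map obtained from `f` by raising its height over `eᗮ` by `c` and rotating it about `eᗮ`
along the spherical cap `(α, β)`. -/
def rotate (e : F) (α : G → ℝ) (β : G → G) (c : ℝ) (f : E → F) (p : E × G) : F × G :=
  (f p.1 + ((⟪f p.1, e⟫_ℝ + c) * α p.2 - ⟪f p.1, e⟫_ℝ) • e, (⟪f p.1, e⟫_ℝ + c) • β p.2)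

theorem contDiff_rotate {e : F} {α : G → ℝ} {β : G → G} (hα : IsSphericalCap α β) (c : ℝ)
    {f : E → F} (hf : ContDiff ℝ ∞ f) : ContDiff ℝ ∞ (rotate e α β c f) := by
  have h1 : ContDiff ℝ ∞ fun p : E × G => f p.1 := hf.comp contDiff_fst
  have h2 : ContDiff ℝ ∞ fun p : E × G => α p.2 := hα.contDiff_fst.comp contDiff_snd
  have h3 : ContDiff ℝ ∞ fun p : E × G => β p.2 := hα.contDiff_snd.comp contDiff_snd
  have h4 : ContDiff ℝ ∞ fun p : E × G => ⟪f p.1, e⟫_ℝ := h1.inner ℝ contDiff_const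
  exact (h1.add ((((h4.add contDiff_const).mul h2).sub h4).smul contDiff_const)).prodMk
    ((h4.add contDiff_const).smul h3)

theorem fderiv_rotate_apply {e : F} {α : G → ℝ} {β : G → G} (hα : IsSphericalCap α β) (c : ℝ)
    {f : E → F} (hf : ContDiff ℝ ∞ f) (p q : E × G) :
    fderiv ℝ (rotate e α β c f) p q =
      (fderiv ℝ f p.1 q.1 + (⟪fderiv ℝ f p.1 q.1, e⟫_ℝ * α p.2
          + (⟪f p.1, e⟫_ℝ + c) * fderiv ℝ α p.2 q.2 - ⟪fderiv ℝ f p.1 q.1, e⟫_ℝ) • e,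
        ⟪fderiv ℝ f p.1 q.1, e⟫_ℝ • β p.2 + (⟪f p.1, e⟫_ℝ + c) • fderiv ℝ β p.2 q.2) := by
  have h1 : HasFDerivAt (fun p : E × G => f p.1) _ p :=
    (hf.differentiable (by simp) p.1).hasFDerivAt.comp p hasFDerivAt_fst
  have h2 : HasFDerivAt (fun p : E × G => α p.2) _ p :=
    (hα.contDiff_fst.differentiable (by simp) p.2).hasFDerivAt.comp p hasFDerivAt_snd
  have h3 : HasFDerivAt (fun p : E × G => β p.2) _ p :=
    (hα.contDiff_snd.differentiable (by simp) p.2).hasFDerivAt.comp p hasFDerivAt_snd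
  have h4 : HasFDerivAt (fun p : E × G => ⟪f p.1, e⟫_ℝ) _ p :=
    h1.inner ℝ (hasFDerivAt_const e p)
  have h5 : HasFDerivAt (rotate e α β c f) _ p :=
    (h1.add ((((h4.add_const c).mul h2).sub h4).smul_const e)).prodMk ((h4.add_const c).smul h3)
  rw [h5.fderiv]
  ext1
  · simp
    congr 1
    ring
  · simp
    abel

/-- The data can be recovered continuously: `ρ` is the length of the rotated component, which gives
back `f`, and the ratio of its two coordinates gives `β / α`. -/
theorem isEmbedding_rotate {e : F} (he : ‖e‖ = 1) {α : G → ℝ} {β : G → G}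
    (hα : IsSphericalCap α β) {c : ℝ} (hc : 0 < c) {f : E → F} (hf : ContDiff ℝ ∞ f)
    (hemb : Topology.IsEmbedding f) (hpos : ∀ x, 0 < ⟪f x, e⟫_ℝ) :
    Topology.IsEmbedding (rotate e α β c f) := by
  -- The maximum with `c / 2` makes the division continuous on the whole space; it changes nothing
  -- on the image, where the coordinate along `e` is `ρ α ≥ c / 2`.
  let Γ : F × G → F × G := fun q =>
    (q.1 + (√(⟪q.1, e⟫_ℝ ^ 2 + ‖q.2‖ ^ 2) - c - ⟪q.1, e⟫_ℝ) • e,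
      (max ⟪q.1, e⟫_ℝ (c / 2))⁻¹ • q.2)
  have hΓ : Continuous Γ := by
    have h0 : ∀ q : F × G, max ⟪q.1, e⟫_ℝ (c / 2) ≠ 0 := fun q =>
      ((half_pos hc).trans_le (le_max_right _ _)).ne'
    have h1 : Continuous fun q : F × G => ⟪q.1, e⟫_ℝ := by fun_prop
    have h2 : Continuous fun q : F × G => (max ⟪q.1, e⟫_ℝ (c / 2))⁻¹ :=
      (h1.max continuous_const).inv₀ h0
    have h3 : Continuous fun q : F × G => √(⟪q.1, e⟫_ℝ ^ 2 + ‖q.2‖ ^ 2) := by fun_prop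
    exact (by fun_prop : Continuous fun q : F × G =>
      q.1 + (√(⟪q.1, e⟫_ℝ ^ 2 + ‖q.2‖ ^ 2) - c - ⟪q.1, e⟫_ℝ) • e).prodMk
      (h2.smul continuous_snd)
  refine Topology.IsEmbedding.of_comp (contDiff_rotate hα c hf).continuous hΓ ?_
  have hcomp : Γ ∘ rotate e α β c f = Prod.map f fun u => (α u)⁻¹ • β u := by
    funext ⟨x, u⟩
    have hρ : 0 < ⟪f x, e⟫_ℝ + c := add_pos (hpos x) hc
    have hee : ⟪e, e⟫_ℝ = 1 := by rw [real_inner_self_eq_norm_sq, he, one_pow]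
    have ht : ⟪(rotate e α β c f (x, u)).1, e⟫_ℝ = (⟪f x, e⟫_ℝ + c) * α u := by
      simp only [rotate, inner_add_left, real_inner_smul_left, hee]
      ring
    have hr : √(((⟪f x, e⟫_ℝ + c) * α u) ^ 2 + ‖(rotate e α β c f (x, u)).2‖ ^ 2)
        = ⟪f x, e⟫_ℝ + c := by
      rw [Real.sqrt_eq_iff_mul_self_eq_of_pos hρ]
      simp only [rotate, norm_smul, mul_pow, Real.norm_eq_abs, sq_abs]
      rw [← mul_add, hα.sphere u]
      ring
    have hle : c / 2 ≤ (⟪f x, e⟫_ℝ + c) * α u := by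
      have := hα.half_le u
      nlinarith [hpos x]
    have hα0 : α u ≠ 0 := (lt_of_lt_of_le one_half_pos (hα.half_le u)).ne'
    simp only [Γ, Function.comp_apply, ht, hr, max_eq_left hle, Prod.map_apply]
    ext1
    · simp only [rotate]
      module
    · simp only [rotate, smul_smul]
      congr 1
      field_simp
  rw [hcomp]
  exact hemb.prodMap hα.embedding

/-- The product `F × G` carries the sup norm, so `T` transports the construction to a space `F'`
whose inner product is the Euclidean one of the product. -/
theorem IsRotatableDupin.rotate {f ξ : E → F} {e : F} {g : ℕ} {κ : Fin g → E → ℝ}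
    {m : Fin g → ℕ} (h : IsRotatableDupin f ξ e κ m) {α : G → ℝ} {β : G → G}
    (hα : IsSphericalCap α β) (T : (F × G) ≃L[ℝ] F')
    (hT : ∀ p q, ⟪T p, T q⟫_ℝ = ⟪p.1, q.1⟫_ℝ + ⟪p.2, q.2⟫_ℝ) :
    ∃ (f' ξ' : E × G → F') (e' : F') (κ' : Fin (g + 1) → E × G → ℝ),
      IsRotatableDupin f' ξ' e' κ' (Fin.cons (Module.finrank ℝ G) m) := by
  obtain ⟨B, hB⟩ := h.height
  obtain ⟨a, ha, haξ⟩ := h.slope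
  have hee : ⟪e, e⟫_ℝ = 1 := by rw [real_inner_self_eq_norm_sq, h.norm_axis, one_pow]
  -- Since `⟪ξ, e⟫ ≤ 1` and `ρ ≥ c`, this shift gives `⟪ξ, e⟫ / ρ ≤ a / 2`, half the bound on the
  -- old curvatures.
  let c := 2 / a
  have hc : 0 < c := by positivity
  let ρ : E → ℝ := fun x => ⟪f x, e⟫_ℝ + c
  have hρ : ∀ x, 0 < ρ x := fun x => add_pos (hB x).1 hc
  have hρs : ContDiff ℝ ∞ ρ := (h.contDiff_map.inner ℝ contDiff_const).add contDiff_const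
  let η : E → ℝ := fun x => ⟪ξ x, e⟫_ℝ
  have hηs : ContDiff ℝ ∞ η := h.contDiff_normal.inner ℝ contDiff_const
  have hη1 : ∀ x, η x ≤ 1 := fun x => by
    simpa [h.norm_normal x, h.norm_axis] using real_inner_le_norm (ξ x) e
  have hη0 : ∀ x, 0 < η x := fun x => ha.trans_le (haξ x).1
  let Φ := _root_.rotate e α β c f
  let Ψ := _root_.rotate e α β 0 ξ
  have hΦ : ContDiff ℝ ∞ Φ := contDiff_rotate hα c h.contDiff_map
  have hΨ : ContDiff ℝ ∞ Ψ := contDiff_rotate hα 0 h.contDiff_normal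
  have hdΦ : ∀ p q, fderiv ℝ (fun p => T (Φ p)) p q = T (fderiv ℝ Φ p q) := fun p q =>
    DFunLike.congr_fun (T.comp_fderiv (f := Φ) (x := p)) q
  have hdΨ : ∀ p q, fderiv ℝ (fun p => T (Ψ p)) p q = T (fderiv ℝ Ψ p q) := fun p q =>
    DFunLike.congr_fun (T.comp_fderiv (f := Ψ) (x := p)) q
  have hα1 : ∀ u, α u ≤ 1 := fun u => by
    nlinarith [hα.sphere u, sq_nonneg ‖β u‖, hα.half_le u]
  let κ₀ : E → ℝ := fun x => -(η x / ρ x)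
  have hκ₀s : ContDiff ℝ ∞ κ₀ := (hηs.div hρs fun x => (hρ x).ne').neg
  have hκ₀ : ∀ x, -(a / 2) ≤ κ₀ x := by
    intro x
    have : η x / ρ x ≤ a / 2 := by
      rw [div_le_iff₀ (hρ x)]
      have h1 : a * c = 2 := by simp only [c]; field_simp
      have h2 : c ≤ ρ x := le_add_of_nonneg_left (hB x).1.le
      nlinarith [hη1 x]
    simp only [κ₀]
    linarith
  have hinj : ∀ p q, fderiv ℝ Φ p q = 0 → q = 0 := by
    intro p q h0
    simp only [Φ] at h0
    rw [fderiv_rotate_apply hα c h.contDiff_map, Prod.mk_eq_zero] at h0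
    obtain ⟨h1, h2⟩ := h0
    have hd := hα.inner_deriv p.2 q.2
    have hsph := hα.sphere p.2
    have hρ0 := hρ p.1
    change 0 < ⟪f p.1, e⟫_ℝ + c at hρ0
    generalize ⟪f p.1, e⟫_ℝ + c = r at h1 h2 hρ0
    have h3 := congrArg (fun v => ⟪v, e⟫_ℝ) h1
    simp only [inner_add_left, real_inner_smul_left, hee, inner_zero_left] at h3
    have h4 := congrArg (fun v => ⟪β p.2, v⟫_ℝ) h2
    simp only [inner_add_right, real_inner_smul_right, real_inner_self_eq_norm_sq,
      inner_zero_right] at h4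
    -- Pairing with the radial vector `(α, β)` isolates the change of `ρ`, because the derivative of
    -- `(α, β)` is orthogonal to it.
    have hs : ⟪fderiv ℝ f p.1 q.1, e⟫_ℝ = 0 := by
      linear_combination α p.2 * h3 + h4 - r * hd - ⟪fderiv ℝ f p.1 q.1, e⟫_ℝ * hsph
    rw [hs] at h1 h2 h3
    have hdα : fderiv ℝ α p.2 q.2 = 0 := by
      have : r * fderiv ℝ α p.2 q.2 = 0 := by linarith
      exact (mul_eq_zero.1 this).resolve_left hρ0.ne'
    have hdβ : fderiv ℝ β p.2 q.2 = 0 := by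
      rw [zero_smul, zero_add] at h2
      exact (smul_eq_zero.1 h2).resolve_left hρ0.ne'
    have hq2 := hα.immersion _ _ hdα hdβ
    have hq1 : q.1 = 0 := by
      rw [hdα] at h1
      refine h.immersion p.1 ?_
      simpa using h1
    exact Prod.ext hq1 hq2
  refine ⟨fun p => T (Φ p), fun p => T (Ψ p), T (e, 0),
    Fin.cons (fun p => κ₀ p.1) fun i p => κ i p.1, ?_⟩
  refine
    { contDiff_map := T.contDiff.comp hΦ
      contDiff_normal := T.contDiff.comp hΨ
      contDiff_curvature := ?_
      embedding := T.toHomeomorph.isEmbedding.comp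
        (isEmbedding_rotate h.norm_axis hα hc h.contDiff_map h.embedding fun x => (hB x).1)
      immersion := ?_
      norm_normal := ?_
      orthogonal := ?_
      principal := ?_
      injective := ?_
      norm_axis := ?_
      height := ⟨B + c, ?_⟩
      -- `a / 2` comes from `α ≥ 1 / 2`, and the other term from `⟪ξ, e⟫ ≥ a` and `ρ ≤ |B| + c`; the
      -- absolute value makes positivity immediate.
      slope := ⟨min (a / 2) (a / (|B| + c)), ?_, ?_⟩ }
  · refine Fin.cases ?_ fun i => ?_
    · exact hκ₀s.comp contDiff_fst
    · exact (h.contDiff_curvature i).comp contDiff_fst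
  · intro p
    rw [injective_iff_map_eq_zero]
    intro q hq
    rw [hdΦ, T.map_eq_zero_iff] at hq
    exact hinj p q hq
  · intro p
    have hsq : ‖T (Ψ p)‖ ^ 2 = 1 := by
      have hsph := hα.sphere p.2
      have hξ : ⟪ξ p.1, ξ p.1⟫_ℝ = 1 := by
        rw [real_inner_self_eq_norm_sq, h.norm_normal, one_pow]
      rw [← real_inner_self_eq_norm_sq, hT]
      simp only [Ψ, _root_.rotate, inner_add_left, inner_add_right, real_inner_smul_left,
        real_inner_smul_right, hee, hξ, real_inner_comm (ξ p.1) e, add_zero,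
        real_inner_self_eq_norm_sq (β p.2)]
      linear_combination ⟪ξ p.1, e⟫_ℝ ^ 2 * hsph
    exact (pow_eq_one_iff_of_nonneg (norm_nonneg _) two_ne_zero).1 hsq
  · intro p q
    rw [hdΦ, hT]
    simp only [Φ]
    rw [fderiv_rotate_apply hα c h.contDiff_map]
    have hd := hα.inner_deriv p.2 q.2
    have hsph := hα.sphere p.2
    have horth := h.orthogonal p.1 q.1
    simp only [Ψ, _root_.rotate, inner_add_left, inner_add_right, real_inner_smul_left,
      real_inner_smul_right, hee, horth, real_inner_comm (fderiv ℝ f p.1 q.1) e, add_zero,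
      real_inner_self_eq_norm_sq (β p.2)]
    linear_combination ⟪ξ p.1, e⟫_ℝ * ⟪fderiv ℝ f p.1 q.1, e⟫_ℝ * hsph
      + ⟪ξ p.1, e⟫_ℝ * (⟪f p.1, e⟫_ℝ + c) * hd
  · refine Fin.cases (fun p => ?_) fun i p => ?_
    -- In the rotation directions both differentials are multiples of the derivative of `(α, β)`, by
    -- `ρ` for the map and by `⟪ξ, e⟫` for the normal.
    · refine ⟨LinearMap.range (LinearMap.inr ℝ E G), ?_, ?_⟩
      · rw [Fin.cons_zero]
        exact LinearMap.finrank_range_of_inj LinearMap.inr_injective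
      · rintro _ ⟨k, rfl⟩
        rw [hdΦ, hdΨ]
        simp only [Φ, Ψ, Fin.cons_zero]
        rw [fderiv_rotate_apply hα c h.contDiff_map, fderiv_rotate_apply hα 0 h.contDiff_normal,
          ← T.map_smul (κ₀ p.1), ← T.map_neg]
        have hρ0 := (hρ p.1).ne'
        have hmul : κ₀ p.1 * (⟪f p.1, e⟫_ℝ + c) = -⟪ξ p.1, e⟫_ℝ := by
          change -(η p.1 / ρ p.1) * ρ p.1 = -η p.1
          field_simp
        refine ⟨congrArg T (Prod.ext ?_ ?_), ?_⟩
        · simp [smul_smul, ← mul_assoc, hmul]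
        · simp [smul_smul, hmul]
        · have := ((hκ₀s.differentiable (by simp) p.1).hasFDerivAt.comp p
            hasFDerivAt_fst).fderiv
          change fderiv ℝ (fun p : E × G => κ₀ p.1) p = _ at this
          rw [this]
          simp
    · obtain ⟨D, hD, hD'⟩ := h.principal i p.1
      -- In the profile directions both differentials arise from those of `f` and `ξ` by the same
      -- linear map, so the eigenvalue equation is preserved.
      refine ⟨D.map (LinearMap.inl ℝ E G), ?_, ?_⟩
      · rw [Fin.cons_succ, ← hD]
        exact (Submodule.equivMapOfInjective _ LinearMap.inl_injective D).finrank_eq.symm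
      · rintro _ ⟨k, hk, rfl⟩
        obtain ⟨h1, h2⟩ := hD' k hk
        rw [hdΦ, hdΨ]
        simp only [Φ, Ψ, Fin.cons_succ]
        rw [fderiv_rotate_apply hα c h.contDiff_map, fderiv_rotate_apply hα 0 h.contDiff_normal,
          ← T.map_smul (κ i p.1), ← T.map_neg]
        refine ⟨congrArg T (Prod.ext ?_ ?_), ?_⟩
        · simp only [LinearMap.inl_apply, h1, map_zero, inner_neg_left, real_inner_smul_left,
            Prod.smul_mk, Prod.neg_mk]
          module
        · simp only [LinearMap.inl_apply, h1, map_zero, inner_neg_left, real_inner_smul_left,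
            Prod.smul_mk, Prod.neg_mk]
          module
        · have := (((h.contDiff_curvature i).differentiable (by simp) p.1).hasFDerivAt.comp p
            hasFDerivAt_fst).fderiv
          change fderiv ℝ (fun p : E × G => κ i p.1) p = _ at this
          rw [this]
          simpa using h2
  · intro p i j hij
    have hne : ∀ i, κ₀ p.1 ≠ κ i p.1 := fun i => by
      have := hκ₀ p.1
      have := (haξ p.1).2 i
      intro h
      linarith
    induction i using Fin.cases <;> induction j using Fin.cases
    · rfl
    · exact absurd hij (hne _)
    · exact absurd hij.symm (hne _)
    · exact congrArg Fin.succ (h.injective p.1 hij)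
  · have : ‖T (e, 0)‖ ^ 2 = 1 := by
      rw [← real_inner_self_eq_norm_sq, hT]
      simp [h.norm_axis]
    exact (pow_eq_one_iff_of_nonneg (norm_nonneg _) two_ne_zero).1 this
  · intro p
    have : ⟪T (Φ p), T (e, 0)⟫_ℝ = ρ p.1 * α p.2 := by
      rw [hT]
      simp only [Φ, _root_.rotate, inner_add_left, real_inner_smul_left, hee, inner_zero_right, ρ]
      ring
    rw [this]
    have h1 := hα.half_le p.2
    have h2 := hα1 p.2
    have h3 := hρ p.1
    have h4 : ρ p.1 ≤ B + c := by simpa [ρ] using (hB p.1).2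
    constructor
    · exact mul_pos h3 (by linarith)
    · nlinarith
  · positivity
  · intro p
    have : ⟪T (Ψ p), T (e, 0)⟫_ℝ = η p.1 * α p.2 := by
      rw [hT]
      simp only [Ψ, _root_.rotate, inner_add_left, real_inner_smul_left, hee, inner_zero_right, η]
      ring
    rw [this]
    constructor
    · refine (min_le_left _ _).trans ?_
      have h1 := hα.half_le p.2
      have h2 : a ≤ η p.1 := (haξ p.1).1
      nlinarith
    · refine Fin.cases ?_ fun i => ?_
      · change -(η p.1 / ρ p.1) ≤ _
        rw [neg_le_neg_iff]
        refine (min_le_right _ _).trans ?_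
        refine div_le_div₀ (hη0 p.1).le (haξ p.1).1 (hρ p.1) ?_
        simpa [ρ] using (hB p.1).2.trans (le_abs_self B)
      · change κ i p.1 ≤ _
        have h1 := (haξ p.1).2 i
        have h2 := min_le_left (a / 2) (a / (|B| + c))
        linarith

end Rotation

/-! ### The induction on the number of curvatures -/

theorem IsRotatableDupin.comp_equiv {E E' F : Type*} [NormedAddCommGroup E] [NormedSpace ℝ E]
    [NormedAddCommGroup E'] [NormedSpace ℝ E'] [NormedAddCommGroup F] [InnerProductSpace ℝ F]
    {f ξ : E → F} {e : F} {g : ℕ} {κ : Fin g → E → ℝ} {m : Fin g → ℕ}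
    (h : IsRotatableDupin f ξ e κ m) (φ : E' ≃L[ℝ] E) :
    IsRotatableDupin (f ∘ φ) (ξ ∘ φ) e (fun i => κ i ∘ φ) m where
  contDiff_map := h.contDiff_map.comp φ.contDiff
  contDiff_normal := h.contDiff_normal.comp φ.contDiff
  contDiff_curvature i := (h.contDiff_curvature i).comp φ.contDiff
  embedding := h.embedding.comp φ.toHomeomorph.isEmbedding
  immersion x := by
    rw [φ.comp_right_fderiv]
    exact (h.immersion _).comp φ.injective
  norm_normal x := h.norm_normal _
  orthogonal x k := by
    rw [φ.comp_right_fderiv]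
    exact h.orthogonal _ _
  principal i x := by
    obtain ⟨D, hD, hD'⟩ := h.principal i (φ x)
    refine ⟨D.map φ.symm.toLinearMap, ?_, ?_⟩
    · rw [← hD]
      exact (Submodule.equivMapOfInjective _ φ.symm.injective D).finrank_eq.symm
    · rintro _ ⟨k, hk, rfl⟩
      rw [φ.comp_right_fderiv, φ.comp_right_fderiv, φ.comp_right_fderiv]
      simpa using hD' k hk
  injective x := h.injective _
  norm_axis := h.norm_axis
  height := h.height.imp fun _ hB x => hB _
  slope := h.slope.imp fun _ ha => ⟨ha.1, fun x => ha.2 _⟩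

theorem exists_isRotatableDupin (g : ℕ) : ∀ (d n : ℕ) (m : Fin g → ℕ), ∑ i, m i = d → d + 1 = n →
    ∃ (f ξ : Euc d → Euc n) (e : Euc n) (κ : Fin g → Euc d → ℝ), IsRotatableDupin f ξ e κ m := by
  induction g with
  | zero =>
    rintro d n m hd rfl
    obtain rfl : d = 0 := by simpa using hd.symm
    -- The starting hypersurface is a single point of the line, at height 1, without principal
    -- curvatures.
    let e : Euc 1 := EuclideanSpace.single 0 1
    have he : ‖e‖ = 1 := by simp [e]
    have hee : ⟪e, e⟫_ℝ = 1 := by rw [real_inner_self_eq_norm_sq, he, one_pow]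
    refine ⟨fun _ => e, fun _ => e, e, fun i => i.elim0, ?_⟩
    exact
      { contDiff_map := contDiff_const
        contDiff_normal := contDiff_const
        contDiff_curvature := fun i => i.elim0
        embedding := .of_subsingleton _
        immersion := fun x => Function.injective_of_subsingleton _
        norm_normal := fun _ => he
        orthogonal := fun x k => by simp
        principal := fun i => i.elim0
        injective := fun x => Function.injective_of_subsingleton _
        norm_axis := he
        height := ⟨1, fun x => ⟨one_pos.trans_eq hee.symm, hee.le⟩⟩
        slope := ⟨1, one_pos, fun x => ⟨hee.ge, fun i => i.elim0⟩⟩ }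
  | succ g ih =>
    rintro d n m hd rfl
    rw [Fin.sum_univ_succ] at hd
    obtain ⟨f, ξ, e, κ, h⟩ := ih _ _ (fun i => m i.succ) rfl rfl
    obtain ⟨α, β, hα⟩ := exists_isSphericalCap (G := Euc (m 0))
    -- An orthonormal basis of the `L²` product supplies the isometry onto `Euc (d + 1)`.
    let b := stdOrthonormalBasis ℝ (WithLp 2 (Euc (∑ i : Fin g, m i.succ + 1) × Euc (m 0)))
    have hb : Module.finrank ℝ (WithLp 2 (Euc (∑ i : Fin g, m i.succ + 1) × Euc (m 0)))
        = d + 1 := by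
      rw [(WithLp.linearEquiv 2 ℝ _).finrank_eq]
      simp
      omega
    let τ := (b.reindex (finCongr hb)).repr
    obtain ⟨f', ξ', e', κ', h'⟩ := h.rotate (F' := Euc (d + 1)) hα
      ((WithLp.prodContinuousLinearEquiv 2 ℝ _ _).symm.trans τ.toContinuousLinearEquiv)
      (fun p q => by
        change ⟪τ (WithLp.toLp 2 p), τ (WithLp.toLp 2 q)⟫_ℝ = _
        rw [τ.inner_map_map, WithLp.prod_inner_apply])
    have hφ : Module.finrank ℝ (Euc d)
        = Module.finrank ℝ (Euc (∑ i : Fin g, m i.succ) × Euc (m 0)) := by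
      simp
      omega
    have hm : Fin.cons (Module.finrank ℝ (Euc (m 0))) (fun i => m i.succ) = m := by
      rw [finrank_euclideanSpace_fin]
      exact Fin.cons_self_tail m
    rw [hm] at h'
    exact ⟨_, _, _, _, h'.comp_equiv (ContinuousLinearEquiv.ofFinrankEq hφ)⟩

/-! ### From the parametrized description to the Dupin property -/

section Hypersurface

variable {d n : ℕ} {f ξ : Euc d → Euc n} {e : Euc n} {g : ℕ} {κ : Fin g → Euc d → ℝ}
  {m : Fin g → ℕ}

theorem diffAt_eq_fderiv (f : Euc d → Euc n) (x : Euc d) :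
    diffAt (d := d) f x = fderiv ℝ f x :=
  mfderiv_eq_fderiv

theorem IsRotatableDupin.isOrientedHypersurface (h : IsRotatableDupin f ξ e κ m)
    (hn : d + 1 = n) : IsOrientedHypersurface (d := d) f ξ where
  codim_one := hn
  smooth := h.contDiff_map.contMDiff
  immersion x := by
    rw [diffAt_eq_fderiv]
    exact h.immersion x
  smooth_normal := h.contDiff_normal.contMDiff
  norm_normal := h.norm_normal
  orthogonal x X := by
    rw [diffAt_eq_fderiv]
    exact h.orthogonal x X

/-- As `df` is injective, `A X = c X` can be tested after applying `df`, which turns it into an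
equation between the derivatives of `ξ` and `f`. -/
theorem IsOrientedHypersurface.mem_principalSpace_iff
    (h : IsOrientedHypersurface (d := d) f ξ) (x : Euc d) (c : ℝ) (X : Euc d) :
    X ∈ principalSpace (d := d) f ξ x c ↔ fderiv ℝ ξ x X = -(c • fderiv ℝ f x X) := by
  let Y : Euc d := shapeOperator (d := d) f ξ x X
  have hA : fderiv ℝ f x Y = -fderiv ℝ ξ x X := by
    have := h.diffAt_shapeOperator x X
    rw [diffAt_eq_fderiv, diffAt_eq_fderiv] at this
    exact this
  have hinj : Function.Injective (fderiv ℝ f x) := by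
    rw [← diffAt_eq_fderiv]
    exact h.immersion x
  have hmem : X ∈ principalSpace (d := d) f ξ x c ↔ Y = c • X :=
    Module.End.mem_eigenspace_iff (M := TangentSpace (𝓡 d) x)
  rw [hmem, ← hinj.eq_iff, hA, map_smul, neg_eq_iff_eq_neg]

/-- The subspaces in `IsRotatableDupin.principal` only lie inside the principal spaces; since the `m
i` add up to `d`, they exhaust them. -/
theorem IsRotatableDupin.principalSpace_spec (h : IsRotatableDupin f ξ e κ m)
    (hn : d + 1 = n) (hm : ∀ i, 0 < m i) (hsum : ∑ i, m i = d) (x : Euc d) :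
    (∀ i, multiplicityAt (d := d) f ξ x (κ i x) = m i ∧
      ∀ X ∈ principalSpace (d := d) f ξ x (κ i x), fderiv ℝ (κ i) x X = 0) ∧
    {c | IsPrincipalCurvatureAt (d := d) f ξ x c} = Set.range fun i => κ i x := by
  have hs := h.isOrientedHypersurface hn
  choose D hD hD' using fun i => h.principal i x
  have hfin : FiniteDimensional ℝ (TangentSpace (𝓡 d) x) :=
    inferInstanceAs (FiniteDimensional ℝ (Euc d))
  obtain ⟨h1, h2⟩ := eigenspace_eq_of_sum_finrank_eq (V := TangentSpace (𝓡 d) x)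
    (shapeOperator (d := d) f ξ x) (h.injective x) (D := D) hm
    (fun i X hX => (hs.mem_principalSpace_iff x (κ i x) X).2 (hD' i X hX).1) hD
    (hsum.trans (finrank_euclideanSpace_fin (𝕜 := ℝ) (n := d)).symm)
  refine ⟨fun i => ⟨?_, fun X hX => ?_⟩, h2⟩
  · unfold multiplicityAt principalSpace
    rw [h1 i]
    exact hD i
  · unfold principalSpace at hX
    rw [h1 i] at hX
    exact (hD' i X hX).2

/-- The eigenvalue `c` is locally constant along a map `θ` from an open set whose tangent
spaces consist of eigenvectors. -/
theorem IsRotatableDupin.eventually_eq (h : IsRotatableDupin f ξ e κ m) {k : ℕ}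
    {θ : Euc k → Euc d} {c : Euc k → ℝ} {O : Set (Euc k)} (hO : IsOpen O)
    (hθ : ContDiffOn ℝ ∞ θ O) {t₀ : Euc k} (ht₀ : t₀ ∈ O) {v₀ : Euc k}
    (hv₀ : ∀ t ∈ O, fderiv ℝ θ t v₀ ≠ 0) (hc : ∀ t ∈ O, ∃ i, c t = κ i (θ t))
    (hξ : ∀ t ∈ O, ∀ v,
      fderiv ℝ ξ (θ t) (fderiv ℝ θ t v) = -(c t • fderiv ℝ f (θ t) (fderiv ℝ θ t v)))
    (hκ : ∀ i, ∀ t ∈ O, c t = κ i (θ t) → ∀ v, fderiv ℝ (κ i) (θ t) (fderiv ℝ θ t v) = 0) :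
    ∀ᶠ t in nhds t₀, c t = c t₀ := by
  have hd : ContinuousOn (fun t => fderiv ℝ θ t v₀) O :=
    (hθ.continuousOn_fderiv_of_isOpen hO (by simp)).clm_apply continuousOn_const
  have hW : ContinuousOn (fun t => fderiv ℝ f (θ t) (fderiv ℝ θ t v₀)) O :=
    ((h.contDiff_map.continuous_fderiv (by simp)).comp_continuousOn hθ.continuousOn).clm_apply hd
  have hZ : ContinuousOn (fun t => fderiv ℝ ξ (θ t) (fderiv ℝ θ t v₀)) O :=
    ((h.contDiff_normal.continuous_fderiv (by simp)).comp_continuousOn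
      hθ.continuousOn).clm_apply hd
  have hW0 : ∀ t ∈ O, ⟪fderiv ℝ f (θ t) (fderiv ℝ θ t v₀),
      fderiv ℝ f (θ t) (fderiv ℝ θ t v₀)⟫_ℝ ≠ 0 := fun t ht => by
    rw [inner_self_ne_zero]
    exact (map_ne_zero_iff _ (h.immersion (θ t))).2 (hv₀ t ht)
  have hcO : ContinuousOn c O := by
    -- No continuity of `c` is given; it follows by writing `c` as the quotient `-⟪dξ w, df w⟫ / ⟪df
    -- w, df w⟫` with `w` the image of `v₀`.
    refine ((ContinuousOn.inner (𝕜 := ℝ) hZ hW).neg.div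
      (ContinuousOn.inner (𝕜 := ℝ) hW hW) hW0).congr fun t ht => ?_
    rw [Pi.div_apply, Pi.neg_apply, eq_div_iff (hW0 t ht)]
    rw [hξ t ht, inner_neg_left, real_inner_smul_left, neg_neg]
  have hct := hcO.continuousAt (hO.mem_nhds ht₀)
  obtain ⟨i, hi⟩ := hc t₀ ht₀
  -- By continuity `c` stays away from the other curvatures, which differ from `κ i` at `θ t₀`; so
  -- near `t₀` it follows the single branch `κ i`, whose derivative along `θ` vanishes.
  have hne : ∀ j, ∀ᶠ t in nhds t₀, j ≠ i → c t ≠ κ j (θ t) := by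
    intro j
    by_cases hj : j = i
    · simp [hj]
    · have hjt : ContinuousAt (fun t => c t - κ j (θ t)) t₀ :=
        hct.sub ((h.contDiff_curvature j).continuous.continuousAt.comp
          (hθ.continuousOn.continuousAt (hO.mem_nhds ht₀)))
      have hj0 : c t₀ - κ j (θ t₀) ≠ 0 := by
        rw [hi, sub_ne_zero]
        exact fun h0 => hj (h.injective _ h0).symm
      filter_upwards [hjt.eventually_ne hj0] with t ht _ using sub_ne_zero.1 ht
  have hev : ∀ᶠ t in nhds t₀, t ∈ O ∧ c t = κ i (θ t) := by
    filter_upwards [Filter.eventually_all.2 hne, hO.mem_nhds ht₀] with t ht htO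
    obtain ⟨j, hj⟩ := hc t htO
    by_cases hji : j = i
    · exact ⟨htO, hji ▸ hj⟩
    · exact absurd hj (ht j hji)
  obtain ⟨r, hr, hball⟩ := Metric.eventually_nhds_iff_ball.1 hev
  have hdiff : ∀ t ∈ Metric.ball t₀ r, HasFDerivAt (fun t => κ i (θ t))
      ((fderiv ℝ (κ i) (θ t)).comp (fderiv ℝ θ t)) t := fun t ht =>
    ((h.contDiff_curvature i).differentiable (by simp) (θ t)).hasFDerivAt.comp t
      ((hθ.contDiffAt (hO.mem_nhds (hball t ht).1)).differentiableAt (by simp)).hasFDerivAt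
  filter_upwards [Metric.ball_mem_nhds t₀ hr] with t ht
  rw [(hball t ht).2, hi]
  refine Metric.isOpen_ball.is_const_of_fderiv_eq_zero (𝕜 := ℝ)
    (convex_ball t₀ r).isPreconnected
    (fun t ht => (hdiff t ht).differentiableAt.differentiableWithinAt) (fun t ht => ?_)
    ht (Metric.mem_ball_self hr)
  rw [(hdiff t ht).fderiv]
  ext v
  exact hκ i t (hball t ht).1 (hball t ht).2 v

/-- Charts of the curvature surface reduce the claim to `IsRotatableDupin.eventually_eq`;
connectedness then passes from locally constant to constant. -/
theorem IsRotatableDupin.isDupin (h : IsRotatableDupin f ξ e κ m)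
    (hn : d + 1 = n) (hm : ∀ i, 0 < m i) (hsum : ∑ i, m i = d) : IsDupin d f ξ := by
  intro k S _ _ _ _ ι c hι
  have hs := h.isOrientedHypersurface hn
  have hspec := h.principalSpace_spec hn hm hsum
  have hloc : IsLocallyConstant c := by
    rw [IsLocallyConstant.iff_eventually_eq]
    intro s₀
    let φ := chartAt (Euc k) s₀
    have hφ := mdifferentiable_chart (I := 𝓡 k) s₀
    let θ : Euc k → Euc d := ι ∘ φ.symm
    have hθ : ContDiffOn ℝ ∞ θ φ.target :=
      contMDiffOn_iff_contDiffOn.1 (hι.smooth.comp_contMDiffOn contMDiffOn_chart_symm)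
    have hcomp : ∀ t ∈ φ.target, ∀ v : Euc k, fderiv ℝ θ t v =
        mfderiv (𝓡 k) (𝓡 d) ι (φ.symm t) (mfderiv (𝓡 k) (𝓡 k) φ.symm t v) := by
      intro t ht v
      have := mfderiv_comp t (hι.smooth.mdifferentiable (by simp) (φ.symm t))
        (hφ.mdifferentiableAt_symm ht)
      rw [← mfderiv_eq_fderiv]
      exact DFunLike.congr_fun this v
    have hmem : ∀ t ∈ φ.target, ∀ v : Euc k,
        fderiv ℝ θ t v ∈ principalSpace (d := d) f ξ (θ t) (c (φ.symm t)) := by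
      intro t ht v
      rw [hcomp t ht v]
      have := hι.tangent (φ.symm t)
      exact this.le ⟨_, rfl⟩
    have hinj : ∀ t ∈ φ.target, ∀ v : Euc k, v ≠ 0 → fderiv ℝ θ t v ≠ 0 := by
      intro t ht v hv h0
      rw [hcomp t ht v] at h0
      have h1 : mfderiv (𝓡 k) (𝓡 k) φ.symm t v = 0 :=
        hι.immersion (φ.symm t) (h0.trans (map_zero _).symm)
      have h2 := DFunLike.congr_fun (hφ.comp_symm_deriv ht) v
      refine hv (h2.symm.trans ?_)
      change mfderiv (𝓡 k) (𝓡 k) φ (φ.symm t) (mfderiv (𝓡 k) (𝓡 k) φ.symm t v) = 0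
      rw [h1]
      exact map_zero _
    -- A curvature surface has positive dimension, because an eigenspace of an eigenvalue is
    -- nonzero.
    have hv : ∃ v : Euc k, v ≠ 0 := by
      by_contra! hv
      refine hι.principal s₀ ?_
      change principalSpace (d := d) f ξ (ι s₀) (c s₀) = ⊥
      rw [← hι.tangent s₀, eq_bot_iff]
      rintro _ ⟨v, rfl⟩
      have : v = 0 := hv v
      rw [this]
      exact map_zero _
    obtain ⟨v₀, hv₀⟩ := hv
    have hc : ∀ t ∈ φ.target, ∃ i, c (φ.symm t) = κ i (θ t) := by
      intro t _
      have := hι.principal (φ.symm t)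
      obtain ⟨i, hi⟩ := (hspec (θ t)).2.le this
      exact ⟨i, hi.symm⟩
    have hev := h.eventually_eq (c := fun t => c (φ.symm t)) φ.open_target hθ
      (φ.map_source (mem_chart_source _ s₀)) (fun t ht => hinj t ht v₀ hv₀) hc
      (fun t ht v => (hs.mem_principalSpace_iff _ _ _).1 (hmem t ht v))
      (fun i t ht hi v => ((hspec (θ t)).1 i).2 _ (hi ▸ hmem t ht v))
    have hsrc := chart_source_mem_nhds (Euc k) s₀
    filter_upwards [(φ.continuousAt (mem_chart_source _ s₀)).eventually hev, hsrc] with s h1 h2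
    rwa [φ.left_inv h2, φ.left_inv (mem_chart_source _ s₀)] at h1
  exact fun s t => hloc.apply_eq_of_preconnectedSpace s t

end Hypersurface

/-- For positive integers `m₁, …, m_g` with `m₁ + ⋯ + m_g = n - 1` there is a (connected, embedded)
proper Dupin hypersurface in `ℝⁿ` with `g` distinct principal curvatures of multiplicities
`m₁, …, m_g`. -/
theorem theorem11p1 (g n : ℕ) (m : Fin g → ℕ) (hm : ∀ i, 0 < m i) (hsum : ∑ i, m i + 1 = n) :
    ∃ (M : Type) (_ : TopologicalSpace M) (_ : ChartedSpace (Euc (n - 1)) M)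
      (_ : IsManifold (𝓡 (n - 1)) ∞ M) (_ : T2Space M) (_ : SecondCountableTopology M)
      (_ : ConnectedSpace M) (f ξ : M → Euc n),
      Topology.IsEmbedding f ∧ IsProperDupin (n - 1) f ξ ∧
      HasPrincipalCurvaturesOfMultiplicity (n - 1) f ξ m := by
  have hd : ∑ i, m i = n - 1 := by omega
  have hn : n - 1 + 1 = n := by omega
  obtain ⟨f, ξ, e, κ, h⟩ := exists_isRotatableDupin g (n - 1) n m hd hn
  have hspec := h.principalSpace_spec hn hm hd
  refine ⟨Euc (n - 1), inferInstance, inferInstance, inferInstance, inferInstance, inferInstance,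
    inferInstance, f, ξ, h.embedding, ⟨h.isOrientedHypersurface hn, h.isDupin hn hm hd, ?_⟩,
    κ, fun i => (h.contDiff_curvature i).contMDiff, fun x => ⟨h.injective x, (hspec x).2,
      fun i => ((hspec x).1 i).1⟩⟩
  intro x y
  rw [(hspec x).2, (hspec y).2, ← Set.image_univ, ← Set.image_univ,
    Set.ncard_image_of_injective _ (h.injective x), Set.ncard_image_of_injective _ (h.injective y)]
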